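/- For an algebraic number $\alpha\in\mathbb{C}$, let $\sigma_1,\dots,\sigma_s$ be the real embeddings of $\mathbb{Q}(\alpha)$ and let $\tau_1,\overline{\tau_1},\dots,\tau_t,\overline{\tau_t}$ be its non-real complex embeddings, grouped into conjugate pairs. The absolute size of $\alpha$ is $$\|\alpha\|=\Bigl(\sum_{i=1}^{s}\sigma_i(\alpha)^2+\sum_{j=1}^{t}|\tau_j(\alpha)|^2\Bigr)^{1/2}.$$ Theorem. There is an absolute constant $C$ such that the following holds. Let $k\ge 1$ be an integer, let $n=4k+2$, and let $\alpha\in\mathbb{C}$ be any root of the polynomial $$x^n+x^{n-2}+\dots+x^2-1=\sum_{j=1}^{n/2}x^{2j}-1 .$$ Then $\alpha$ is algebraic of degree $n$ over $\mathbb{Q}$, exactly two of its conjugates over $\mathbb{Q}$ are real, and $$\Bigl|\,\|\alpha\|^2-\Bigl(\frac n2+\log 2\Bigr)\Bigr|\le C\,n^{-1/4}.$$ -/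

import Mathlib

open Polynomial IntermediateField NumberField

noncomputable section

open scoped Classical in
/-- The Euclidean norm on `ℝ^s × ℂ^t`, where `s` and `t` are the numbers of real and of complex
places of `K`: the square root of the sum of the `x_i ^ 2` over the real coordinates and of the
`y_j ^ 2 + z_j ^ 2` over the complex coordinates `y_j + z_j √-1`. -/
def euclideanSize (K : Type*) [Field K] [NumberField K] (x : mixedEmbedding.mixedSpace K) : ℝ :=
  √((∑ w, x.1 w ^ 2) + ∑ w, ((x.2 w).re ^ 2 + (x.2 w).im ^ 2))

/-- The relative size `‖α‖_K` of an element `α` of a number field `K`: the Euclidean norm of the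
image of `α` under the canonical embedding `K → ℝ^s × ℂ^t`. -/
def relativeSize (K : Type*) [Field K] [NumberField K] (α : K) : ℝ :=
  euclideanSize K (mixedEmbedding K α)

/-- The field `ℚ(α)` generated by an algebraic number `α` is a number field. -/
theorem numberField_adjoin {α : ℂ} (hα : IsAlgebraic ℚ α) : NumberField ℚ⟮α⟯ :=
  { to_charZero := inferInstance
    to_finiteDimensional := adjoin.finiteDimensional hα.isIntegral }

/-- The absolute size `‖α‖` of an algebraic number `α`: its relative size with respect to the
field `ℚ(α)`. -/
def absoluteSize (α : ℂ) (hα : IsAlgebraic ℚ α) : ℝ :=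
  haveI := numberField_adjoin hα
  relativeSize ℚ⟮α⟯ (AdjoinSimple.gen ℚ α)

/-- The polynomial `x^n + x^(n-2) + ⋯ + x^2 - 1`, for even `n`. -/
def evenPoly (n : ℕ) : ℚ[X] :=
  (∑ j ∈ Finset.Icc 1 (n / 2), X ^ (2 * j)) - 1

end

/-! Put `n = 2 * m` and `y = z ^ 2`. Multiplying the equation `y + ⋯ + y ^ m = 1` by `y - 1` gives
`y ^ (m + 1) = 2 * y - 1`. Equality in the triangle inequality forces every solution with `‖y‖ ≤ 1`
to be the positive real one, `r ^ 2`, which is `1 / 2 + O(1 / m)`. The other solutions satisfy `‖y‖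
^ m ≤ 3`, so `‖y‖ = 1 + log ‖y‖ + O(1 / m ^ 2)`.

The zeros have product of modulus 1, so `log ‖z ^ 2‖` summed over the `2 * m - 2` non-real zeros is
`-2 * log (r ^ 2) ≈ 2 * log 2`. Hence their `‖z‖ ^ 2` sum to about `2 * m - 2 + 2 * log 2`. Halving
for conjugate pairs and adding `2 * r ^ 2 ≈ 1` gives `m + log 2`, with error `O(1 / m)`.

Irreducibility uses the same location of zeros: a nonconstant integral factor has unit constant
term, so it vanishes at `r` or `-r`, both simple zeros. A proper factorization would therefore be `c
* f(x) * f(-x)`, which is impossible modulo 4. -/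

open Polynomial IntermediateField NumberField

/-! ### Location of the solutions of `y + ⋯ + y ^ m = 1`. -/

/-- The closed form of `y + ⋯ + y ^ m - 1` after multiplication by `y - 1`. -/
theorem sub_one_mul_sum_Icc_pow {R : Type*} [CommRing R] (m : ℕ) (y : R) :
    (y - 1) * (∑ j ∈ Finset.Icc 1 m, y ^ j - 1) = y ^ (m + 1) - 2 * y + 1 := by
  induction m with
  | zero => simp; ring
  | succ m ih =>
    rw [Finset.sum_Icc_succ_top (by omega)]
    linear_combination ih

theorem sum_Icc_pow_strictMonoOn {m : ℕ} (hm : 1 ≤ m) :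
    StrictMonoOn (fun y : ℝ => ∑ j ∈ Finset.Icc 1 m, y ^ j) (Set.Ici 0) := by
  intro a ha b _ hab
  have ha : 0 ≤ a := ha
  refine Finset.sum_lt_sum_of_nonempty ⟨1, by simp [hm]⟩ fun j hj => ?_
  exact pow_lt_pow_left₀ hab ha (by have := (Finset.mem_Icc.1 hj).1; omega)

theorem exists_pos_sum_Icc_sq_pow_eq_one {m : ℕ} (hm : 1 ≤ m) :
    ∃ r : ℝ, 0 < r ∧ ∑ j ∈ Finset.Icc 1 m, (r ^ 2) ^ j = 1 := by
  have hc : ContinuousOn (fun r : ℝ => ∑ j ∈ Finset.Icc 1 m, (r ^ 2) ^ j) (Set.Icc 0 1) := by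
    fun_prop
  have h0 : ∑ j ∈ Finset.Icc 1 m, ((0 : ℝ) ^ 2) ^ j = 0 :=
    Finset.sum_eq_zero fun j hj => by
      have := (Finset.mem_Icc.1 hj).1
      simp; omega
  have h1 : (1 : ℝ) ≤ ∑ j ∈ Finset.Icc 1 m, ((1 : ℝ) ^ 2) ^ j := by simpa using hm
  obtain ⟨r, hr, h⟩ := intermediate_value_Icc (zero_le_one' ℝ) hc
    (show (1 : ℝ) ∈ Set.Icc _ _ from ⟨by simp only [h0]; norm_num, h1⟩)
  refine ⟨r, lt_of_le_of_ne hr.1 ?_, h⟩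
  rintro rfl
  simp only [h0] at h
  norm_num at h

/-- A complex solution of `y + ⋯ + y ^ m = 1` in the closed unit disc is a positive real. -/
theorem eq_norm_of_sum_Icc_pow_eq_one {m : ℕ} (hm : 2 ≤ m) {y : ℂ}
    (hy : ∑ j ∈ Finset.Icc 1 m, y ^ j = 1) (hle : ‖y‖ ≤ 1) :
    y = ‖y‖ ∧ ∑ j ∈ Finset.Icc 1 m, ‖y‖ ^ j = 1 := by
  have hy1 : y ≠ 1 := by
    rintro rfl
    simp at hy
    omega
  have key := sub_one_mul_sum_Icc_pow m y
  rw [hy, sub_self, mul_zero] at key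
  have h2y : 1 + y ^ (m + 1) = 2 * y := by linear_combination -key
  have hn : 2 * ‖y‖ = ‖1 + y ^ (m + 1)‖ := by rw [h2y]; simp
  have htri : ‖1 + y ^ (m + 1)‖ ≤ 1 + ‖y‖ ^ (m + 1) := by
    simpa using norm_add_le (1 : ℂ) (y ^ (m + 1))
  have hge : 1 ≤ ∑ j ∈ Finset.Icc 1 m, ‖y‖ ^ j := by
    simpa [hy] using norm_sum_le (Finset.Icc 1 m) (fun j => y ^ j)
  have keyn := sub_one_mul_sum_Icc_pow m ‖y‖
  -- `htri` gives `≤`. For `≥`, multiply `hge` by `‖y‖ - 1 ≤ 0` and use `keyn`.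
  have heq : 2 * ‖y‖ = 1 + ‖y‖ ^ (m + 1) := by nlinarith
  have hray : SameRay ℝ (1 : ℂ) (y ^ (m + 1)) := by
    rw [sameRay_iff_norm_add, ← hn, heq]
    simp
  have hpow : y ^ (m + 1) = ((‖y‖ ^ (m + 1) : ℝ) : ℂ) := by
    have := hray.norm_smul_eq
    simpa using this
  have hyn : y = ‖y‖ := by
    have h3 : (2 : ℂ) * ‖y‖ = 1 + ((‖y‖ ^ (m + 1) : ℝ) : ℂ) := by exact_mod_cast heq
    rw [hpow, ← h3] at h2y
    exact (mul_left_cancel₀ two_ne_zero h2y).symm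
  refine ⟨hyn, ?_⟩
  have : ((∑ j ∈ Finset.Icc 1 m, ‖y‖ ^ j : ℝ) : ℂ) = 1 := by
    push_cast
    rw [← hyn, hy]
  exact_mod_cast this

/-- The complex solutions of `z ^ 2 + z ^ 4 + ⋯ + z ^ (2 * m) = 1` in the closed unit disc are
the two real ones. -/
theorem eq_or_eq_neg_of_norm_le_one {m : ℕ} (hm : 2 ≤ m) {r : ℝ}
    (h : ∑ j ∈ Finset.Icc 1 m, (r ^ 2) ^ j = 1) {z : ℂ}
    (hz : ∑ j ∈ Finset.Icc 1 m, (z ^ 2) ^ j = 1) (hle : ‖z‖ ≤ 1) : z = r ∨ z = -r := by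
  obtain ⟨h1, h2⟩ := eq_norm_of_sum_Icc_pow_eq_one hm hz
    (by rw [norm_pow]; exact pow_le_one₀ (norm_nonneg z) hle)
  have h3 : ‖z ^ 2‖ = r ^ 2 := (sum_Icc_pow_strictMonoOn (by omega : 1 ≤ m)).injOn
    (norm_nonneg _) (sq_nonneg r) (h2.trans h.symm)
  rw [h3] at h1
  exact sq_eq_sq_iff_eq_or_eq_neg.1 (by exact_mod_cast h1)

theorem eq_or_eq_neg_of_im_eq_zero {m : ℕ} (hm : 1 ≤ m) {r : ℝ}
    (h : ∑ j ∈ Finset.Icc 1 m, (r ^ 2) ^ j = 1) {z : ℂ}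
    (hz : ∑ j ∈ Finset.Icc 1 m, (z ^ 2) ^ j = 1) (him : z.im = 0) : z = r ∨ z = -r := by
  obtain ⟨x, rfl⟩ : ∃ x : ℝ, z = x := ⟨z.re, by apply Complex.ext <;> simp [him]⟩
  have hx : ∑ j ∈ Finset.Icc 1 m, (x ^ 2) ^ j = 1 := by exact_mod_cast hz
  have : x ^ 2 = r ^ 2 := (sum_Icc_pow_strictMonoOn hm).injOn
    (sq_nonneg x) (sq_nonneg r) (hx.trans h.symm)
  rcases sq_eq_sq_iff_eq_or_eq_neg.1 this with h | h
  · left; rw [h]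
  · right; rw [h]; simp

/-- The positive solution of `y + ⋯ + y ^ m = 1` is close to `1 / 2`. -/
theorem two_mul_sq_sub_one_bounds {m : ℕ} (hm : 2 ≤ m) {r : ℝ}
    (h : ∑ j ∈ Finset.Icc 1 m, (r ^ 2) ^ j = 1) :
    0 < 2 * r ^ 2 - 1 ∧ 2 * r ^ 2 - 1 ≤ 2 / m := by
  set y := r ^ 2 with hy
  have hy0 : 0 ≤ y := sq_nonneg r
  have hsub : ∑ j ∈ Finset.Icc 1 2, y ^ j ≤ ∑ j ∈ Finset.Icc 1 m, y ^ j :=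
    Finset.sum_le_sum_of_subset_of_nonneg (Finset.Icc_subset_Icc_right hm)
      fun j _ _ => pow_nonneg hy0 j
  rw [h, Finset.sum_Icc_succ_top (by norm_num)] at hsub
  simp at hsub
  -- From `y + y ^ 2 ≤ 1`; the bound `2 / 3` then pairs with Bernoulli's inequality for `3 / 2`.
  have hle : y ≤ 2 / 3 := by nlinarith
  have key := sub_one_mul_sum_Icc_pow m y
  rw [h, sub_self, mul_zero] at key
  have hpos : 0 < y := by
    rcases hy0.lt_or_eq with h0 | h0
    · exact h0
    · rw [← h0] at key; simp at key
  have e : 2 * y - 1 = y ^ (m + 1) := by linarith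
  rw [e]
  refine ⟨by positivity, ?_⟩
  have h1 : y ^ (m + 1) ≤ (2 / 3 : ℝ) ^ m :=
    (pow_le_pow_of_le_one hy0 (by linarith) (Nat.le_succ m)).trans
      (pow_le_pow_left₀ hy0 hle m)
  have h2 : 1 + (m : ℝ) * (1 / 2) ≤ (1 + 1 / 2 : ℝ) ^ m :=
    one_add_mul_le_pow (by norm_num) m
  have hm0 : (0 : ℝ) < m := by exact_mod_cast (by omega : 0 < m)
  have h3 : (2 / 3 : ℝ) ^ m * (1 + 1 / 2 : ℝ) ^ m = 1 := by
    rw [← mul_pow]; norm_num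
  rw [le_div_iff₀ hm0]
  have h4 : (0 : ℝ) < (2 / 3 : ℝ) ^ m := by positivity
  nlinarith

/-- Solutions of `y + ⋯ + y ^ m = 1` outside the unit disc are close to the unit circle. -/
theorem norm_sub_one_sub_log_bounds {m : ℕ} (hm : 2 ≤ m) {y : ℂ}
    (hy : ∑ j ∈ Finset.Icc 1 m, y ^ j = 1) (hlt : 1 < ‖y‖) :
    |‖y‖ - 1 - Real.log ‖y‖| ≤ 4 / (m : ℝ) ^ 2 := by
  have hm0 : (2 : ℝ) ≤ m := by exact_mod_cast hm
  have key := sub_one_mul_sum_Icc_pow m y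
  rw [hy, sub_self, mul_zero] at key
  have e : y ^ (m + 1) = 2 * y - 1 := by linear_combination -key
  -- This yields `‖y‖ ^ m ≤ 3`, so `t = log ‖y‖` is at most `2 / m`, and `|exp t - 1 - t| ≤ t ^ 2`
  -- finishes.
  have h1 : ‖y‖ ^ m * ‖y‖ ≤ 3 * ‖y‖ := by
    rw [← pow_succ, ← norm_pow, e]
    calc ‖2 * y - 1‖ ≤ ‖2 * y‖ + ‖(1 : ℂ)‖ := norm_sub_le _ _
      _ ≤ 3 * ‖y‖ := by simp; linarith
  have h2 : ‖y‖ ^ m ≤ 3 := le_of_mul_le_mul_right h1 (by linarith)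
  have h3 : m * Real.log ‖y‖ ≤ 2 := by
    rw [← Real.log_pow]
    have := Real.log_le_sub_one_of_pos (show 0 < ‖y‖ ^ m by positivity)
    linarith
  have h4 : 0 < Real.log ‖y‖ := Real.log_pos hlt
  have h5 : Real.log ‖y‖ ≤ 2 / m := by
    rw [le_div_iff₀ (by linarith)]; linarith
  have h6 : (2 : ℝ) / m ≤ 1 := by rw [div_le_one (by linarith)]; exact hm0
  have h7 := Real.abs_exp_sub_one_sub_id_le (x := Real.log ‖y‖)
    (by rw [abs_of_pos h4]; linarith)
  rw [Real.exp_log (by linarith)] at h7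
  refine h7.trans ?_
  calc Real.log ‖y‖ ^ 2 ≤ (2 / m) ^ 2 := pow_le_pow_left₀ h4.le h5 2
    _ = 4 / (m : ℝ) ^ 2 := by rw [div_pow]; norm_num

/-! ### Irreducibility. -/

/-- The integral model `x ^ (2 * m) + ⋯ + x ^ 2 - 1` of `evenPoly (2 * m)`. -/
noncomputable def evenPolyInt (m : ℕ) : ℤ[X] :=
  (∑ j ∈ Finset.Icc 1 m, X ^ (2 * j)) - 1

theorem map_evenPolyInt (m : ℕ) : (evenPolyInt m).map (Int.castRingHom ℚ) = evenPoly (2 * m) := by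
  simp [evenPolyInt, evenPoly, Polynomial.map_sum]

theorem aeval_evenPolyInt {A : Type*} [CommRing A] (m : ℕ) (z : A) :
    aeval z (evenPolyInt m) = ∑ j ∈ Finset.Icc 1 m, (z ^ 2) ^ j - 1 := by
  simp [evenPolyInt, pow_mul]

theorem coeff_zero_evenPolyInt (m : ℕ) : (evenPolyInt m).coeff 0 = -1 := by
  have : ∑ j ∈ Finset.Icc 1 m, (X ^ (2 * j) : ℤ[X]).coeff 0 = 0 :=
    Finset.sum_eq_zero fun j hj => by
      have := (Finset.mem_Icc.1 hj).1
      rw [coeff_X_pow, if_neg (by omega)]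
  simp only [evenPolyInt, coeff_sub, finsetSum_coeff, this, coeff_one_zero, zero_sub]

theorem coeff_two_mul_evenPolyInt {m i : ℕ} (hi : 1 ≤ i) (him : i ≤ m) :
    (evenPolyInt m).coeff (2 * i) = 1 := by
  have : ∑ j ∈ Finset.Icc 1 m, (X ^ (2 * j) : ℤ[X]).coeff (2 * i) = 1 := by
    rw [Finset.sum_eq_single i]
    · simp
    · intro j _ hj
      rw [coeff_X_pow, if_neg (by omega)]
    · intro h
      exact absurd (Finset.mem_Icc.2 ⟨hi, him⟩) h
  simp only [evenPolyInt, coeff_sub, finsetSum_coeff, this, coeff_one]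
  rw [if_neg (by omega), sub_zero]

theorem natDegree_evenPolyInt_le (m : ℕ) : (evenPolyInt m).natDegree ≤ 2 * m := by
  refine (natDegree_sub_le _ _).trans (max_le ?_ (by simp))
  refine natDegree_sum_le_of_forall_le _ _ fun j hj => ?_
  have := (Finset.mem_Icc.1 hj).2
  rw [natDegree_X_pow]
  omega

theorem monic_evenPolyInt {m : ℕ} (hm : 1 ≤ m) : (evenPolyInt m).Monic :=
  monic_of_natDegree_le_of_coeff_eq_one _ (natDegree_evenPolyInt_le m)
    (coeff_two_mul_evenPolyInt hm le_rfl)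

theorem natDegree_evenPolyInt {m : ℕ} (hm : 1 ≤ m) : (evenPolyInt m).natDegree = 2 * m :=
  le_antisymm (natDegree_evenPolyInt_le m)
    (le_natDegree_of_ne_zero (by rw [coeff_two_mul_evenPolyInt hm le_rfl]; exact one_ne_zero))

/-- The two real zeros of `evenPolyInt m` are simple. -/
theorem aeval_derivative_evenPolyInt_ne_zero {m : ℕ} (hm : 1 ≤ m) {r : ℝ} (hr : r ≠ 0) :
    aeval (r : ℂ) (derivative (evenPolyInt m)) ≠ 0 := by
  have hd : aeval r (derivative (evenPolyInt m)) =
      r * ∑ j ∈ Finset.Icc 1 m, (2 * j : ℝ) * (r ^ 2) ^ (j - 1) := by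
    simp only [evenPolyInt, derivative_sub, derivative_X_pow, derivative_one,
      sub_zero, map_sum, Finset.mul_sum]
    refine Finset.sum_congr rfl fun j hj => ?_
    obtain ⟨i, rfl⟩ := Nat.exists_eq_add_of_le (Finset.mem_Icc.1 hj).1
    simp only [map_mul, map_natCast, map_pow, aeval_X]
    rw [show 2 * (1 + i) - 1 = 2 * i + 1 by omega, show 1 + i - 1 = i by omega, ← pow_mul]
    push_cast
    ring
  have hpos : 0 < ∑ j ∈ Finset.Icc 1 m, (2 * j : ℝ) * (r ^ 2) ^ (j - 1) := by
    refine Finset.sum_pos (fun j hj => ?_) ⟨1, by simp [hm]⟩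
    have : 0 < j := (Finset.mem_Icc.1 hj).1
    positivity
  have hne : aeval r (derivative (evenPolyInt m)) ≠ 0 := by
    rw [hd]
    exact mul_ne_zero hr hpos.ne'
  rw [show (r : ℂ) = algebraMap ℝ ℂ r from rfl, aeval_algebraMap_apply]
  exact fun h => hne ((map_eq_zero _).1 h)

theorem Multiset.one_lt_norm_prod {s : Multiset ℂ} (hs : s ≠ 0) (h : ∀ z ∈ s, 1 < ‖z‖) :
    1 < ‖s.prod‖ := by
  induction s using Multiset.induction with
  | empty => exact absurd rfl hs
  | cons a s ih =>
    rw [Multiset.prod_cons, norm_mul]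
    have ha := h a (Multiset.mem_cons_self a s)
    by_cases h0 : s = 0
    · simpa [h0] using ha
    · have := ih h0 fun z hz => h z (Multiset.mem_cons_of_mem hz)
      nlinarith

/-- A nonconstant integral polynomial with unit leading and constant coefficients has a complex
zero in the closed unit disc. -/
theorem exists_aeval_eq_zero_norm_le_one {A : ℤ[X]} (hdeg : 0 < A.natDegree)
    (hlead : IsUnit A.leadingCoeff) (hzero : IsUnit (A.coeff 0)) :
    ∃ z : ℂ, aeval z A = 0 ∧ ‖z‖ ≤ 1 := by
  by_contra! hcon
  set B := A.map (Int.castRingHom ℂ) with hB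
  have hinj : Function.Injective (Int.castRingHom ℂ) := Int.cast_injective
  have hsplit : B.Splits := IsAlgClosed.splits B
  have hBdeg : B.natDegree = A.natDegree := natDegree_map_eq_of_injective hinj A
  have hroots : B.roots ≠ 0 := by
    intro h
    have := hsplit.natDegree_eq_card_roots
    rw [h, hBdeg] at this
    simp at this
    omega
  have hlt := Multiset.one_lt_norm_prod hroots fun z hz => hcon z (by
    have := isRoot_of_mem_roots hz
    rwa [hB, IsRoot.def, eval_map, ← algebraMap_int_eq, ← aeval_def] at this)
  -- By Vieta and the unit coefficients the product of the zeros has modulus 1, against `hlt`.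
  have h0 := congrArg norm hsplit.coeff_zero_eq_leadingCoeff_mul_prod_roots
  rw [hB, coeff_map, leadingCoeff_map_of_injective hinj] at h0
  rcases Int.isUnit_iff.1 hlead with h1 | h1 <;> rcases Int.isUnit_iff.1 hzero with h2 | h2 <;>
    simp [h1, h2] at h0 <;> rw [← hB] at h0 <;> linarith

/-- `x ^ (2 * m) + ⋯ + x ^ 2 - 1` is not of the form `c * f(x) * f(-x)`. -/
theorem evenPolyInt_ne_mul_comp_neg_X {m : ℕ} (hm : 2 ≤ m) (c : ℤ) (f : ℤ[X]) :
    evenPolyInt m ≠ f * (f.comp (-X) * C c) := by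
  intro h
  have hc (i : ℕ) : (f.comp (-X)).coeff i = (-1) ^ i * f.coeff i := by
    rw [show (-X : ℤ[X]) = C (-1) * X by simp, comp_C_mul_X_coeff, mul_comm]
  have h0 := coeff_zero_evenPolyInt m
  have h2 := coeff_two_mul_evenPolyInt (i := 1) le_rfl (by omega : 1 ≤ m)
  have h4 := coeff_two_mul_evenPolyInt (i := 2) one_le_two hm
  rw [h, ← mul_assoc, coeff_mul_C, coeff_mul] at h0 h2 h4
  simp only [hc, Finset.Nat.sum_antidiagonal_eq_sum_range_succ_mk, Finset.sum_range_succ,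
    Finset.sum_range_zero] at h0 h2 h4
  norm_num at h0 h2 h4
  generalize f.coeff 0 = a0 at *
  generalize f.coeff 1 = a1 at *
  generalize f.coeff 2 = a2 at *
  generalize f.coeff 3 = a3 at *
  generalize f.coeff 4 = a4 at *
  have hc1 : c = -1 := by
    have hu : IsUnit c := IsUnit.of_mul_eq_one (-(a0 * a0)) (by linear_combination -h0)
    rcases Int.isUnit_iff.1 hu with rfl | rfl
    · nlinarith [mul_self_nonneg a0]
    · rfl
  subst hc1
  -- All of `a0`, `a1`, `a2` turn out odd, so the left side is 1 and the right side 3 modulo 4.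
  have e2 : a1 * a1 = 1 + 2 * (a0 * a2) := by linear_combination h2
  have e4 : a2 * a2 = 2 * (a1 * a3 - a0 * a4) - 1 := by linear_combination -h4
  have hodd {x t : ℤ} (hx : x * x = 2 * t + 1) : Odd x :=
    (Int.odd_mul.1 (show Odd (x * x) from ⟨t, hx⟩)).1
  have o2 : Odd a2 := hodd (t := a1 * a3 - a0 * a4 - 1) (by rw [e4]; ring)
  have o1 : Odd a1 := hodd (t := a0 * a2) (by rw [e2]; ring)
  have o0 : Odd a0 := hodd (t := 0) (by linear_combination -h0)
  obtain ⟨x, hx⟩ := o1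
  obtain ⟨y, hy⟩ := o0.mul o2
  rw [hy, hx] at e2
  have : 4 * (x * x + x) = 4 * y + 2 := by linear_combination e2
  omega

/-- `x ^ (2 * m) + ⋯ + x ^ 2 - 1` is irreducible over `ℤ` for `m ≥ 2`. -/
theorem irreducible_evenPolyInt {m : ℕ} (hm : 2 ≤ m) : Irreducible (evenPolyInt m) := by
  have hm1 : 1 ≤ m := by omega
  obtain ⟨r, hr, hsum⟩ := exists_pos_sum_Icc_sq_pow_eq_one hm1
  have hmonic := monic_evenPolyInt hm1
  have hroot : aeval (r : ℂ) (evenPolyInt m) = 0 := by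
    rw [aeval_evenPolyInt, sub_eq_zero]
    exact_mod_cast hsum
  have hroot' : aeval (-r : ℂ) (evenPolyInt m) = 0 := by
    rw [aeval_evenPolyInt, neg_sq, ← aeval_evenPolyInt, hroot]
  have hsimple {A B : ℤ[X]} (hAB : A * B ∣ evenPolyInt m) {z : ℂ} (hz : z = r ∨ z = -r)
      (hA : aeval z A = 0) (hB : aeval z B = 0) : False := by
    obtain ⟨D, hD⟩ := hAB
    have hne : aeval z (derivative (evenPolyInt m)) ≠ 0 := by
      rcases hz with rfl | rfl
      · exact aeval_derivative_evenPolyInt_ne_zero hm1 hr.ne'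
      · simpa using aeval_derivative_evenPolyInt_ne_zero hm1 (r := -r) (by simpa using hr.ne')
    exact hne (by simp [hD, derivative_mul, hA, hB])
  have hfactor {A : ℤ[X]} (hA : A ∣ evenPolyInt m) (hdeg : 0 < A.natDegree) :
      ∃ z : ℂ, (z = r ∨ z = -r) ∧ aeval z A = 0 := by
    obtain ⟨D, hD⟩ := hA
    have hl : IsUnit A.leadingCoeff := IsUnit.of_mul_eq_one D.leadingCoeff
      (by rw [← leadingCoeff_mul, ← hD, hmonic.leadingCoeff])
    have h0 : IsUnit (A.coeff 0) := IsUnit.of_mul_eq_one (-D.coeff 0)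
      (by rw [mul_neg, ← mul_coeff_zero, ← hD, coeff_zero_evenPolyInt, neg_neg])
    obtain ⟨z, hz, hle⟩ := exists_aeval_eq_zero_norm_le_one hdeg hl h0
    refine ⟨z, eq_or_eq_neg_of_norm_le_one hm hsum ?_ hle, hz⟩
    rw [← sub_eq_zero, ← aeval_evenPolyInt, hD, map_mul, hz, zero_mul]
  have hint : IsIntegral ℤ (r : ℂ) := ⟨_, hmonic, by rwa [← aeval_def]⟩
  set f := minpoly ℤ (r : ℂ) with hf
  have hfr : aeval (r : ℂ) f = 0 := minpoly.aeval ℤ _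
  obtain ⟨q, hq⟩ := minpoly.isIntegrallyClosed_dvd hint hroot
  rw [← hf] at hq
  have hqr (h : aeval (r : ℂ) q = 0) : False := hsimple hq.symm.dvd (.inl rfl) hfr h
  -- If `f` takes both `r` and `-r`, none is left for `q`, which must be constant. Otherwise `-r` is
  -- a zero of `q`, so `q` is `f(-x)` times a cofactor `s`, and `s` is constant for the same reason.
  by_cases hfr' : aeval (-r : ℂ) f = 0
  · have hq0 : q.natDegree = 0 := by
      by_contra hne
      obtain ⟨z, rfl | rfl, hz⟩ := hfactor ⟨f, by rw [hq, mul_comm]⟩ (Nat.pos_of_ne_zero hne)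
      · exact hqr hz
      · exact hsimple hq.symm.dvd (.inr rfl) hfr' hz
    have hqm : q.Monic := (minpoly.monic hint).of_mul_monic_left (hq ▸ hmonic)
    rw [hqm.natDegree_eq_zero.1 hq0, mul_one] at hq
    rw [hq]
    exact minpoly.irreducible hint
  · have hqr' : aeval (-r : ℂ) q = 0 := by
      rw [hq, map_mul] at hroot'
      exact (mul_eq_zero.1 hroot').resolve_left hfr'
    have hdvd : f ∣ q.comp (-X) := minpoly.isIntegrallyClosed_dvd hint (by
      rw [aeval_comp]; simpa using hqr')
    rw [dvd_comp_neg_X_iff] at hdvd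
    obtain ⟨s, hs⟩ := hdvd
    have hgr : aeval (-r : ℂ) (f.comp (-X)) = 0 := by
      rw [aeval_comp]; simpa using hfr
    have hs0 : s.natDegree = 0 := by
      by_contra hne
      obtain ⟨z, rfl | rfl, hz⟩ := hfactor
        ⟨f * f.comp (-X), by rw [hq, hs]; ring⟩ (Nat.pos_of_ne_zero hne)
      · exact hqr (by rw [hs, map_mul, hz, mul_zero])
      · exact hsimple (A := f.comp (-X)) (B := s) ⟨f, by rw [hq, hs]; ring⟩ (.inr rfl) hgr hz
    rw [eq_C_of_natDegree_eq_zero hs0] at hs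
    exact absurd (hq.trans (by rw [hs])) (evenPolyInt_ne_mul_comp_neg_X hm _ f)

theorem minpoly_eq_evenPoly {m : ℕ} (hm : 2 ≤ m) {α : ℂ}
    (h : aeval α (evenPoly (2 * m)) = 0) : minpoly ℚ α = evenPoly (2 * m) := by
  have hmonic := monic_evenPolyInt (by omega : 1 ≤ m)
  have hirr := (hmonic.irreducible_iff_irreducible_map_fraction_map (K := ℚ)).1
    (irreducible_evenPolyInt hm)
  rw [algebraMap_int_eq, map_evenPolyInt] at hirr
  exact (minpoly.eq_of_irreducible_of_monic hirr h
    (map_evenPolyInt m ▸ hmonic.map _)).symm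

/-! ### The absolute size as a weighted sum over conjugates. -/

open InfinitePlace in
open scoped Classical in
theorem relativeSize_sq (K : Type*) [Field K] [NumberField K] (x : K) :
    relativeSize K x ^ 2 = ∑ w : InfinitePlace K, w x ^ 2 := by
  rw [relativeSize, euclideanSize, Real.sq_sqrt (by positivity)]
  rw [← Fintype.sum_subtype_add_sum_subtype (fun w : InfinitePlace K => IsReal w)]
  congr 1
  · refine Finset.sum_congr rfl fun w _ => ?_
    rw [mixedEmbedding.mixedEmbedding_apply_isReal, ← norm_embedding_of_isReal w.2,
      Real.norm_eq_abs, sq_abs]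
  · refine Fintype.sum_equiv
      (Equiv.subtypeEquivRight fun w => not_isReal_iff_isComplex.symm) _ _ fun w => ?_
    rw [mixedEmbedding.mixedEmbedding_apply_isComplex, ← norm_embedding_eq, Complex.sq_norm,
      Complex.normSq_apply]
    simp [sq]

-- A place `w` comes from `mult w` embeddings: one if real, two if complex, whence the weights.
open InfinitePlace in
open scoped Classical in
theorem sum_infinitePlace_eq_sum_embeddings (K : Type*) [Field K] [NumberField K] (x : K) :
    ∑ w : InfinitePlace K, w x ^ 2 =
      ∑ φ : K →+* ℂ, (if ComplexEmbedding.IsReal φ then 1 else 1 / 2) * ‖φ x‖ ^ 2 := by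
  rw [← Finset.sum_fiberwise Finset.univ InfinitePlace.mk]
  refine Finset.sum_congr rfl fun w _ => ?_
  have h (φ : K →+* ℂ) (hφ : φ ∈ ({φ | InfinitePlace.mk φ = w} : Finset _)) :
      (if ComplexEmbedding.IsReal φ then 1 else 1 / 2) * ‖φ x‖ ^ 2 =
        (mult w : ℝ)⁻¹ * w x ^ 2 := by
    rw [← (Finset.mem_filter.mp hφ).2, apply, mult]
    simp only [isReal_mk_iff]
    split_ifs <;> norm_num
  rw [Finset.sum_congr rfl h, Finset.sum_const, card_filter_mk_eq, nsmul_eq_mul, ← mul_assoc,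
    mul_inv_cancel₀ (by exact_mod_cast mult_ne_zero), one_mul]

/-- An embedding and its complex conjugate coincide as soon as they agree on the generator. -/
theorem isReal_iff_im_gen_eq_zero {α : ℂ} (φ : ℚ⟮α⟯ →ₐ[ℚ] ℂ) :
    ComplexEmbedding.IsReal (φ : ℚ⟮α⟯ →+* ℂ) ↔ (φ (AdjoinSimple.gen ℚ α)).im = 0 := by
  rw [ComplexEmbedding.isReal_iff, ← Complex.conj_eq_iff_im]
  constructor
  · intro h
    exact RingHom.congr_fun h (AdjoinSimple.gen ℚ α)
  · intro h
    have : ((Complex.conjAe.toAlgHom.restrictScalars ℚ).comp φ : ℚ⟮α⟯ →ₐ[ℚ] ℂ) = φ :=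
      IntermediateField.algHom_ext_of_eq_adjoin _ rfl (by
        rintro _ rfl
        exact h)
    ext x
    exact AlgHom.congr_fun this x

/-- The square of the absolute size as a sum over the complex conjugates. -/
theorem absoluteSize_sq {α : ℂ} (hα : IsAlgebraic ℚ α) :
    absoluteSize α hα ^ 2 =
      ∑ z ∈ ((minpoly ℚ α).aroots ℂ).toFinset, (if z.im = 0 then 1 else 1 / 2) * ‖z‖ ^ 2 := by
  classical
  have := numberField_adjoin hα
  have hint : IsIntegral ℚ α := hα.isIntegral
  rw [absoluteSize, relativeSize_sq, sum_infinitePlace_eq_sum_embeddings]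
  let e : (ℚ⟮α⟯ →+* ℂ) ≃ {z // z ∈ ((minpoly ℚ α).aroots ℂ).toFinset} :=
    (RingHom.equivRatAlgHom ℚ⟮α⟯ ℂ).trans
      ((algHomAdjoinIntegralEquiv ℚ hint).trans
        (Equiv.subtypeEquivRight fun z => Multiset.mem_toFinset.symm))
  have he (φ : ℚ⟮α⟯ →+* ℂ) : φ (AdjoinSimple.gen ℚ α) = e φ := by
    have := algHomAdjoinIntegralEquiv_symm_apply_gen ℚ hint
      (algHomAdjoinIntegralEquiv ℚ hint (RingHom.equivRatAlgHom ℚ⟮α⟯ ℂ φ))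
    exact (AlgHom.congr_fun ((algHomAdjoinIntegralEquiv ℚ hint).symm_apply_apply _) _).symm.trans
      this
  rw [← Finset.sum_coe_sort ((minpoly ℚ α).aroots ℂ).toFinset]
  refine Fintype.sum_equiv e _ _ fun φ => ?_
  have := isReal_iff_im_gen_eq_zero (RingHom.equivRatAlgHom ℚ⟮α⟯ ℂ φ)
  simp only [← he]
  congr 1
  exact if_congr this rfl rfl

/-! ### The zeros of `evenPoly` and the size estimate. -/

theorem aeval_evenPoly {m : ℕ} {z : ℂ} :
    aeval z (evenPoly (2 * m)) = ∑ j ∈ Finset.Icc 1 m, (z ^ 2) ^ j - 1 := by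
  rw [← aeval_evenPolyInt, ← map_evenPolyInt, ← algebraMap_int_eq, aeval_map_algebraMap]

theorem mem_roots_evenPoly {m : ℕ} (hm : 1 ≤ m) {z : ℂ} :
    z ∈ ((evenPoly (2 * m)).aroots ℂ).toFinset ↔ ∑ j ∈ Finset.Icc 1 m, (z ^ 2) ^ j = 1 := by
  have h0 : evenPoly (2 * m) ≠ 0 :=
    map_evenPolyInt m ▸ ((monic_evenPolyInt hm).map (Int.castRingHom ℚ)).ne_zero
  rw [Multiset.mem_toFinset, mem_aroots, and_iff_right h0, aeval_evenPoly, sub_eq_zero]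

theorem natDegree_evenPoly {m : ℕ} (hm : 1 ≤ m) : (evenPoly (2 * m)).natDegree = 2 * m := by
  rw [← map_evenPolyInt, (monic_evenPolyInt hm).natDegree_map, natDegree_evenPolyInt hm]

theorem nodup_aroots_evenPoly {m : ℕ} (hm : 2 ≤ m) : ((evenPoly (2 * m)).aroots ℂ).Nodup := by
  have hirr := ((monic_evenPolyInt (by omega : 1 ≤ m)).irreducible_iff_irreducible_map_fraction_map
    (K := ℚ)).1 (irreducible_evenPolyInt hm)
  rw [algebraMap_int_eq, map_evenPolyInt] at hirr
  exact nodup_roots hirr.separable.map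

theorem card_roots_evenPoly {m : ℕ} (hm : 2 ≤ m) :
    ((evenPoly (2 * m)).aroots ℂ).toFinset.card = 2 * m := by
  rw [Multiset.toFinset_card_of_nodup (nodup_aroots_evenPoly hm), aroots,
    ← (IsAlgClosed.splits _).natDegree_eq_card_roots, natDegree_map,
    natDegree_evenPoly (by omega)]

/-- Vieta for a monic polynomial with constant term `-1`; this is what determines the sum of the
logarithms. -/
theorem prod_norm_roots_evenPoly {m : ℕ} (hm : 2 ≤ m) :
    ∏ z ∈ ((evenPoly (2 * m)).aroots ℂ).toFinset, ‖z‖ = 1 := by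
  have hmonic : (evenPoly (2 * m)).Monic :=
    map_evenPolyInt m ▸ (monic_evenPolyInt (by omega)).map (Int.castRingHom ℚ)
  have h := (IsAlgClosed.splits ((evenPoly (2 * m)).map
    (algebraMap ℚ ℂ))).coeff_zero_eq_leadingCoeff_mul_prod_roots
  rw [(hmonic.map _).leadingCoeff, coeff_map, ← map_evenPolyInt, coeff_map,
    coeff_zero_evenPolyInt, map_evenPolyInt] at h
  have h' := congrArg norm h
  simp only [norm_mul, norm_pow, norm_neg, norm_one, one_pow, one_mul, map_neg, map_one] at h'
  rw [← norm_prod, Finset.prod, Multiset.toFinset_val, (nodup_aroots_evenPoly hm).dedup,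
    Multiset.map_id', aroots, ← h']

/-- The size of the zeros of `x ^ (2 * m) + ⋯ + x ^ 2 - 1`, as a sum over these zeros. -/
theorem abs_sum_roots_evenPoly_sub_le {m : ℕ} (hm : 2 ≤ m) :
    |∑ z ∈ ((evenPoly (2 * m)).aroots ℂ).toFinset,
      (if z.im = 0 then 1 else 1 / 2) * ‖z‖ ^ 2 - (m + Real.log 2)| ≤ 8 / m := by
  classical
  have hm1 : 1 ≤ m := by omega
  have hm0 : (0 : ℝ) < m := by exact_mod_cast hm1
  obtain ⟨r, hr, hsum⟩ := exists_pos_sum_Icc_sq_pow_eq_one hm1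
  set S := ((evenPoly (2 * m)).aroots ℂ).toFinset with hS
  have hrC : (r : ℂ) ≠ -r := by
    intro h
    have : r = -r := by exact_mod_cast h
    linarith
  have hsumC : ∑ j ∈ Finset.Icc 1 m, ((r : ℂ) ^ 2) ^ j = 1 := by exact_mod_cast hsum
  have hsub : ({(r : ℂ), -(r : ℂ)} : Finset ℂ) ⊆ S := by
    intro z hz
    rw [hS, mem_roots_evenPoly hm1]
    rcases Finset.mem_insert.1 hz with rfl | hz
    · exact hsumC
    · rw [Finset.mem_singleton.1 hz, neg_sq, hsumC]
  set T := S \ {(r : ℂ), -(r : ℂ)} with hT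
  have hsplit (f : ℂ → ℝ) : ∑ z ∈ S, f z = ∑ z ∈ T, f z + (f r + f (-r)) := by
    rw [← Finset.sum_sdiff hsub, Finset.sum_pair hrC]
  have hTS {z : ℂ} (hz : z ∈ T) : ∑ j ∈ Finset.Icc 1 m, (z ^ 2) ^ j = 1 ∧ z ≠ r ∧ z ≠ -r := by
    rw [hT, Finset.mem_sdiff, hS, mem_roots_evenPoly hm1] at hz
    simpa using hz
  have hlt {z : ℂ} (hz : z ∈ T) : 1 < ‖z‖ := by
    by_contra! hle
    obtain ⟨h1, h2, h3⟩ := hTS hz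
    rcases eq_or_eq_neg_of_norm_le_one hm hsum h1 hle with h | h
    · exact h2 h
    · exact h3 h
  have him {z : ℂ} (hz : z ∈ T) : z.im ≠ 0 := by
    intro h0
    obtain ⟨h1, h2, h3⟩ := hTS hz
    rcases eq_or_eq_neg_of_im_eq_zero hm1 hsum h1 h0 with h | h
    · exact h2 h
    · exact h3 h
  have hrn : ‖(r : ℂ)‖ = r := by rw [Complex.norm_real, Real.norm_eq_abs, abs_of_pos hr]
  have hcard : (T.card : ℝ) = 2 * m - 2 := by
    have h := hsplit fun _ => 1
    simp only [Finset.sum_const, nsmul_eq_mul, mul_one] at h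
    rw [hS, card_roots_evenPoly hm] at h
    push_cast at h
    linarith
  have hlog : ∑ z ∈ T, Real.log ‖z ^ 2‖ = -2 * Real.log (r ^ 2) := by
    have hne : ∀ z ∈ S, ‖z‖ ≠ 0 := fun z hz h0 => by
      have := prod_norm_roots_evenPoly hm
      rw [Finset.prod_eq_zero hz h0] at this
      exact zero_ne_one this
    have h : ∑ z ∈ S, Real.log ‖z‖ = 0 := by
      rw [← Real.log_prod hne, prod_norm_roots_evenPoly hm, Real.log_one]
    rw [hsplit, norm_neg, hrn] at h
    simp only [norm_pow, Real.log_pow, ← Finset.mul_sum]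
    push_cast
    linarith
  have hS' : ∑ z ∈ S, (if z.im = 0 then 1 else 1 / 2) * ‖z‖ ^ 2 =
      1 / 2 * ∑ z ∈ T, ‖z ^ 2‖ + 2 * r ^ 2 := by
    rw [hsplit, Finset.mul_sum]
    congr 1
    · exact Finset.sum_congr rfl fun z hz => by rw [if_neg (him hz), norm_pow]
    · simp; ring
  have herr : |∑ z ∈ T, (‖z ^ 2‖ - 1 - Real.log ‖z ^ 2‖)| ≤ 8 / m := by
    calc |∑ z ∈ T, (‖z ^ 2‖ - 1 - Real.log ‖z ^ 2‖)|
        ≤ ∑ z ∈ T, |‖z ^ 2‖ - 1 - Real.log ‖z ^ 2‖| := Finset.abs_sum_le_sum_abs _ _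
      _ ≤ ∑ _z ∈ T, 4 / (m : ℝ) ^ 2 := Finset.sum_le_sum fun z hz =>
          norm_sub_one_sub_log_bounds hm (hTS hz).1
            (by rw [norm_pow]; exact one_lt_pow₀ (hlt hz) two_ne_zero)
      _ = (2 * m - 2) * (4 / (m : ℝ) ^ 2) := by rw [Finset.sum_const, nsmul_eq_mul, hcard]
      _ ≤ (2 * m) * (4 / (m : ℝ) ^ 2) := by gcongr; linarith
      _ = 8 / m := by field_simp; norm_num
  rw [Finset.sum_sub_distrib, Finset.sum_sub_distrib, hlog, Finset.sum_const, nsmul_eq_mul,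
    hcard] at herr
  obtain ⟨hb1, hb2⟩ := two_mul_sq_sub_one_bounds hm hsum
  -- With `E` the sum in `herr`, the total deviation is `E / 2 + (2 * r ^ 2 - 1) - log (2 * r ^ 2)`.
  -- The last two terms together lie between `0` and `2 / m`.
  have hl : Real.log 2 + Real.log (r ^ 2) = Real.log (2 * r ^ 2) :=
    (Real.log_mul two_ne_zero (by positivity)).symm
  have hl1 : 0 ≤ Real.log (2 * r ^ 2) := Real.log_nonneg (by linarith)
  have hl2 := Real.log_le_sub_one_of_pos (show 0 < 2 * r ^ 2 by positivity)
  rw [hS', abs_le]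
  rw [abs_le] at herr
  have h28 : (2 : ℝ) / m = 8 / m / 4 := by ring
  have : 0 < (8 : ℝ) / m := by positivity
  constructor <;> linarith [herr.1, herr.2]

theorem theorem3p7 :
    ∃ C : ℝ, ∀ n k : ℕ, 1 ≤ k → n = 4 * k + 2 →
      ∀ α : ℂ, aeval α (evenPoly n) = 0 →
        (minpoly ℚ α).natDegree = n ∧
        {z : ℂ | IsConjRoot ℚ α z ∧ z.im = 0}.ncard = 2 ∧
        ∃ hα : IsAlgebraic ℚ α,
          |absoluteSize α hα ^ 2 - ((n : ℝ) / 2 + Real.log 2)| ≤ C * (n : ℝ) ^ (-(1 / 4) : ℝ) := by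
  -- The estimate gives `8 / m = 16 / n`, stronger than the required `n ^ (-1 / 4)`.
  refine ⟨16, fun n k hk hn α hα => ?_⟩
  obtain ⟨m, rfl⟩ : ∃ m, n = 2 * m := ⟨2 * k + 1, by omega⟩
  have hm : 2 ≤ m := by omega
  have hm1 : 1 ≤ m := by omega
  have hmin := minpoly_eq_evenPoly hm hα
  have hmonic : (evenPoly (2 * m)).Monic :=
    map_evenPolyInt m ▸ (monic_evenPolyInt hm1).map (Int.castRingHom ℚ)
  have halg : IsAlgebraic ℚ α := ⟨_, hmonic.ne_zero, hα⟩
  refine ⟨hmin ▸ natDegree_evenPoly hm1, ?_, halg, ?_⟩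
  · obtain ⟨r, hr, hsum⟩ := exists_pos_sum_Icc_sq_pow_eq_one hm1
    have hsumC : ∑ j ∈ Finset.Icc 1 m, ((r : ℂ) ^ 2) ^ j = 1 := by exact_mod_cast hsum
    rw [Set.ncard_eq_two]
    refine ⟨r, -r, fun h => ?_, ?_⟩
    · have : r = -r := by exact_mod_cast h
      linarith
    ext z
    rw [Set.mem_ofPred_eq, isConjRoot_iff_aeval_eq_zero halg.isIntegral, hmin, aeval_evenPoly,
      sub_eq_zero]
    constructor
    · rintro ⟨h1, h2⟩
      exact eq_or_eq_neg_of_im_eq_zero hm1 hsum h1 h2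
    · rintro (rfl | rfl)
      · exact ⟨hsumC, Complex.ofReal_im r⟩
      · exact ⟨by rw [neg_sq, hsumC], by simp⟩
  · rw [absoluteSize_sq halg, hmin]
    have hmR : (1 : ℝ) ≤ m := by exact_mod_cast hm1
    have hpow : ((2 * m : ℕ) : ℝ) ^ (-1 : ℝ) ≤ ((2 * m : ℕ) : ℝ) ^ (-(1 / 4) : ℝ) :=
      Real.rpow_le_rpow_of_exponent_le (by push_cast; linarith) (by norm_num)
    rw [Real.rpow_neg_one] at hpow
    have hhalf : ((2 * m : ℕ) : ℝ) / 2 = m := by push_cast; ring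
    rw [hhalf]
    calc _ ≤ 8 / (m : ℝ) := abs_sum_roots_evenPoly_sub_le hm
      _ = 16 * ((2 * m : ℕ) : ℝ)⁻¹ := by push_cast; field_simp; norm_num
      _ ≤ _ := by gcongr
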